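/- Let $G$ be a locally compact (Hausdorff) group and $K\subseteq G$ a compact subgroup with normed Haar measure $\omega$. Let $\mathcal C(G)$ be the space of continuous functions $G\to\mathbb C$ with the topology of uniform convergence on compact sets, and let $\mathcal M_c(G)$ be its dual, i.e. the space of compactly supported complex (regular) Borel measures, with the weak*-topology, $\langle\mu,f\rangle=\int f\,d\mu$. For $f\in\mathcal C(G)$ put $f^{\#}(x)=\int_K\int_K f(kxl)\,d\omega(k)\,d\omega(l)$. Let $\mathcal C(G/\!/K)$ be the space of $f\in\mathcal C(G)$ with $f(kxl)=f(x)$ for all $x\in G$, $k,l\in K$, and let $\mathcal M_c(G/\!/K)$ be the space of $\mu\in\mathcal M_c(G)$ with $\langle\mu,f\rangle=\langle\mu,f^{\#}\rangle$ for all $f\in\mathcal C(G)$. It is an algebra under the convolution $\langle\mu*\nu,f\rangle=\iint f(xy)\,d\mu(x)\,d\nu(y)$, and it acts on $\mathcal C(G/\!/K)$ by $\mu*f(x)=\int f(y^{-1}x)\,d\mu(y)$. For $y\in G$ define $\delta_y^{\#}\in\mathcal M_c(G/\!/K)$ by $\langle\delta_y^{\#},f\rangle=f^{\#}(y)$; then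 $\delta_e^{\#}$ is the unit of $\mathcal M_c(G/\!/K)$. Assume that $(G,K)$ is a Gelfand pair, i.e. that $\mathcal M_c(G/\!/K)$ is commutative. A $K$-variety is a closed linear subspace $V$ of $\mathcal C(G/\!/K)$ such that $\delta_{y^{-1}}^{\#}*f\in V$ for all $f\in V$, $y\in G$. For $f\in\mathcal C(G/\!/K)$ let $\tau(f)$ be the intersection of all $K$-varieties containing $f$, and for a $K$-variety $V$ let $\mathrm{Ann}\,V=\{\mu\in\mathcal M_c(G/\!/K):\mu*f=0\text{ for all }f\in V\}$. A $K$-spherical function is a nonzero $s\in\mathcal C(G/\!/K)$ with $\int_K s(xky)\,d\omega(k)=s(x)s(y)$ for all $x,y\in G$. For such $s$ and $y\in G$ put $D_{s;y}=\delta_{y^{-1}}^{\#}-s(y)\,\delta_e^{\#}$, and let $M_s$ be the weak*-closure of the ideal of $\mathcal M_c(G/\!/K)$ generated by all $D_{s;y}$, $y\in G$. A function $\varphi\in\mathcal C(G/\!/K)$ is a generalized $K$-spherical monomial if there are a $K$-spherical function $s$ and a natural number $n\ge 0$ such that $$D_{s;y_1}*D_{s;y_2}*\dots*D_{s;y_{n+1}}*\varphi(x)=0\qquad\text{for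 all }x,y_1,\dots,y_{n+1}\in G. \tag{1}$$ A maximal ideal of $\mathcal M_c(G/\!/K)$ is called exponential if it is the kernel of a weak*-continuous algebra homomorphism of $\mathcal M_c(G/\!/K)$ onto $\mathbb C$. Lemma. Let $\varphi\in\mathcal C(G/\!/K)$ be nonzero. Then: (i) $\varphi$ is a generalized $K$-spherical monomial if and only if there exists a unique exponential maximal ideal $M$ of $\mathcal M_c(G/\!/K)$ such that $M^{n+1}\subseteq\mathrm{Ann}\,\tau(\varphi)$ for some natural number $n$. (ii) That $M$ is $M_s$ for the corresponding spherical function $s$: if $s$ is a $K$-spherical function and $n$ a natural number such that (1) holds, then $M_s$ is an exponential maximal ideal, $M_s^{n+1}\subseteq\mathrm{Ann}\,\tau(\varphi)\subseteq M_s$, and every exponential maximal ideal $M$ with $M^{m+1}\subseteq\mathrm{Ann}\,\tau(\varphi)$ for some natural number $m$ equals $M_s$. -/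

import Mathlib

open MeasureTheory Topology TopologicalSpace

noncomputable section

namespace KSpherical

section General

variable {X Y : Type*} [TopologicalSpace X] [TopologicalSpace Y]
  [LocallyCompactSpace X] [LocallyCompactSpace Y]

/-- Partial application of a functional: for `h ∈ C(X × Y)`, the continuous function
`x ↦ ⟨ν, h(x, ·)⟩` on `X`. -/
def partialApply (ν : C(Y, ℂ) →L[ℂ] ℂ) : C(X × Y, ℂ) →L[ℂ] C(X, ℂ) where
  toFun h := ⟨fun x => ν (h.curry x), ν.continuous.comp h.curry.continuous⟩
  map_add' h₁ h₂ := by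
    ext x
    exact map_add ν (h₁.curry x) (h₂.curry x)
  map_smul' c h := by
    ext x
    exact map_smul ν c (h.curry x)
  cont := (ContinuousMap.continuous_postcomp (⟨ν, ν.continuous⟩ : C(C(Y, ℂ), ℂ))).comp
    ContinuousMap.continuous_curry

/-- Composition with a fixed continuous map, as a continuous linear map. -/
def pullback (g : C(X, Y)) : C(Y, ℂ) →L[ℂ] C(X, ℂ) where
  toFun f := f.comp g
  map_add' _ _ := rfl
  map_smul' _ _ := rfl
  cont := ContinuousMap.continuous_precomp g

/-- A finite measure on a compact space, as a functional on continuous functions. -/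
def integralCLM [CompactSpace Y] [MeasurableSpace Y] [BorelSpace Y]
    (m : Measure Y) [IsFiniteMeasure m] : C(Y, ℂ) →L[ℂ] ℂ where
  toFun f := ∫ y, f y ∂m
  map_add' f g := integral_add (f.continuous.integrable_of_hasCompactSupport
    (HasCompactSupport.of_compactSpace f)) (g.continuous.integrable_of_hasCompactSupport
    (HasCompactSupport.of_compactSpace g))
  map_smul' c f := integral_const_mul c (fun y => f y)
  cont := by
    refine (LinearMap.mkContinuous (σ := RingHom.id ℂ) (E := C(Y, ℂ)) (F := ℂ)
      { toFun := fun f => ∫ y, f y ∂m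
        map_add' := fun f g => integral_add (f.continuous.integrable_of_hasCompactSupport
          (HasCompactSupport.of_compactSpace f)) (g.continuous.integrable_of_hasCompactSupport
          (HasCompactSupport.of_compactSpace g))
        map_smul' := fun c f => integral_const_mul c (fun y => f y) } (m.real Set.univ)
      fun f => ?_).continuous
    have := norm_integral_le_of_norm_le_const (μ := m) (f := fun y => f y) (C := ‖f‖)
      (Filter.Eventually.of_forall fun y => f.norm_coe_le_norm y)
    simpa [mul_comm] using this

lemma exists_compact_bound (ν : C(X, ℂ) →L[ℂ] ℂ) :
    ∃ L : Set X, IsCompact L ∧ ∃ δ > 0, ∀ f : C(X, ℂ), (∀ x ∈ L, ‖f x‖ < δ) → ‖ν f‖ < 1 := by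
  have h1 : ν ⁻¹' Metric.ball 0 1 ∈ 𝓝 (0 : C(X, ℂ)) :=
    ν.continuous.continuousAt.preimage_mem_nhds (by simpa using Metric.ball_mem_nhds (0:ℂ) one_pos)
  obtain ⟨⟨L, δ⟩, ⟨hL, hδ⟩, h⟩ :=
    ((Metric.nhds_basis_ball (x := (0 : ℂ))).nhds_continuousMapConst (X := X)).mem_iff.1 h1
  refine ⟨L, hL, δ, hδ, fun f hf => ?_⟩
  have := h (show f ∈ _ from fun x hx => by simpa using hf x hx)
  simpa using this

/-- A continuous functional on `C(X)` extends to the continuous functions on a compact set. -/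
lemma exists_extension (ν : C(X, ℂ) →L[ℂ] ℂ) :
    ∃ L : Set X, IsCompact L ∧ ∃ g : C(L, ℂ) →L[ℂ] ℂ, ∀ f : C(X, ℂ), ν f = g (f.restrict L) := by
  obtain ⟨L, hL, δ, hδ, hb⟩ := exists_compact_bound ν
  have : CompactSpace L := isCompact_iff_compactSpace.1 hL
  refine ⟨L, hL, ?_⟩
  let r : C(X, ℂ) →ₗ[ℂ] C(L, ℂ) :=
    { toFun := fun f => f.restrict L, map_add' := fun _ _ => rfl, map_smul' := fun _ _ => rfl }
  have hbound : ∀ f : C(X, ℂ), ‖ν f‖ ≤ (2 / δ) * ‖r f‖ := by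
    intro f
    refine le_of_forall_pos_le_add fun ε hε => ?_
    set t : ℝ := (2 / δ) * ‖r f‖ + ε with ht
    have htpos : 0 < t := by positivity
    have key : ‖ν (((t⁻¹ : ℝ) : ℂ) • f)‖ < 1 := by
      refine hb _ fun x hx => ?_
      have h1 : ‖f x‖ ≤ ‖r f‖ := (r f).norm_coe_le_norm ⟨x, hx⟩
      have h2 : ‖f x‖ < δ * t := by
        have : δ * t = 2 * ‖r f‖ + δ * ε := by rw [ht]; field_simp
        have : 0 < δ * ε := by positivity
        nlinarith [norm_nonneg (r f)]
      rw [ContinuousMap.smul_apply, norm_smul, Complex.norm_real, Real.norm_eq_abs,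
        abs_of_pos (inv_pos.2 htpos), inv_mul_lt_iff₀ htpos, mul_comm]
      exact h2
    rw [map_smul, norm_smul, Complex.norm_real, Real.norm_eq_abs,
        abs_of_pos (inv_pos.2 htpos), inv_mul_lt_iff₀ htpos, mul_one] at key
    exact key.le
  have hker : LinearMap.ker r ≤ LinearMap.ker (ν : C(X, ℂ) →ₗ[ℂ] ℂ) := by
    intro f hf
    have := hbound f
    rw [LinearMap.mem_ker.1 hf, norm_zero, mul_zero] at this
    exact norm_le_zero_iff.1 this
  let g₀ : LinearMap.range r →ₗ[ℂ] ℂ :=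
    ((LinearMap.ker r).liftQ (ν : C(X, ℂ) →ₗ[ℂ] ℂ) hker) ∘ₗ r.quotKerEquivRange.symm.toLinearMap
  have hg₀ : ∀ f, g₀ ⟨r f, f, rfl⟩ = ν f := by
    intro f
    have : r.quotKerEquivRange.symm ⟨r f, f, rfl⟩ = (LinearMap.ker r).mkQ f := by
      rw [LinearEquiv.symm_apply_eq]
      rfl
    show (LinearMap.ker r).liftQ (ν : C(X, ℂ) →ₗ[ℂ] ℂ) hker
      (r.quotKerEquivRange.symm ⟨r f, f, rfl⟩) = ν f
    rw [this]
    rfl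
  obtain ⟨g, hg, -⟩ := exists_extension_norm_eq (LinearMap.range r)
    (g₀.mkContinuous (2 / δ) (by
      rintro ⟨_, f, rfl⟩
      rw [hg₀]
      exact hbound f))
  exact ⟨g, fun f => ((hg ⟨r f, f, rfl⟩).trans (hg₀ f)).symm⟩

/-- A functional on `C(X)` commutes with integration over a compact space. -/
lemma functional_integral_comm [CompactSpace Y] [MeasurableSpace Y] [BorelSpace Y]
    (m : Measure Y) [IsFiniteMeasure m] (ν : C(X, ℂ) →L[ℂ] ℂ) (h : C(X × Y, ℂ)) :
    ν (partialApply (integralCLM m) h) =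
      ∫ y, ν (h.comp ⟨fun x => (x, y), by fun_prop⟩) ∂m := by
  obtain ⟨L, hL, g, hg⟩ := exists_extension ν
  have : CompactSpace L := isCompact_iff_compactSpace.1 hL
  let H : C(Y × L, ℂ) := h.comp ⟨fun p => (p.2.1, p.1), by fun_prop⟩
  have hi : Integrable (fun y => H.curry y) m :=
    H.curry.continuous.integrable_of_hasCompactSupport (HasCompactSupport.of_compactSpace _)
  simp_rw [hg]
  have e : (partialApply (integralCLM m) h).restrict L = ∫ y, H.curry y ∂m := by
    ext x
    rw [ContinuousMap.integral_apply hi]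
    rfl
  rw [e, ← g.integral_comp_comm hi]
  rfl

end General

section Group

variable {G : Type*} [Group G] [TopologicalSpace G] [IsTopologicalGroup G]
  [LocallyCompactSpace G]

/-- `M_c(G)`: the compactly supported complex (regular) Borel measures on `G`. By the Riesz
representation theorem these are exactly the continuous linear functionals on `C(G, ℂ)`, which
carries the topology of uniform convergence on compact sets, and this dual is used here,
with the weak-* topology. The value `μ f` is the integral of `f` with respect to `μ`. -/
abbrev CompactMeasure (G : Type*) [TopologicalSpace G] : Type _ := WeakDual ℂ C(G, ℂ)

/-- The convolution `μ * ν` of measures, `⟨μ * ν, f⟩ = ∫∫ f (x y) dν(y) dμ(x)`. -/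
def conv (μ ν : CompactMeasure G) : CompactMeasure G :=
  StrongDual.toWeakDual (μ.toStrongDual ∘L partialApply ν.toStrongDual ∘L
    pullback (⟨fun p : G × G => p.1 * p.2, by fun_prop⟩ : C(G × G, G)))

lemma continuous_inner (ν : CompactMeasure G) (f : C(G, ℂ)) :
    Continuous fun x : G => ν ⟨fun y => f (x * y), by fun_prop⟩ :=
  (partialApply ν.toStrongDual (f.comp ⟨fun p : G × G => p.1 * p.2, by fun_prop⟩)).continuous

lemma conv_apply (μ ν : CompactMeasure G) (f : C(G, ℂ)) :
    conv μ ν f = μ ⟨fun x => ν ⟨fun y => f (x * y), by fun_prop⟩,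
      continuous_inner ν f⟩ :=
  rfl

/-- The convolution `μ * f` of a measure and a function, `(μ * f)(x) = ∫ f (y⁻¹ x) dμ(y)`. -/
def convFun (μ : CompactMeasure G) : C(G, ℂ) →L[ℂ] C(G, ℂ) :=
  partialApply μ.toStrongDual ∘L
    pullback (⟨fun p : G × G => p.2⁻¹ * p.1, by fun_prop⟩ : C(G × G, G))

lemma convFun_apply (μ : CompactMeasure G) (f : C(G, ℂ)) (x : G) :
    convFun μ f x = μ ⟨fun y => f (y⁻¹ * x), by fun_prop⟩ :=
  rfl

lemma conv_assoc (μ ν ρ : CompactMeasure G) : conv (conv μ ν) ρ = conv μ (conv ν ρ) := by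
  refine DFunLike.ext _ _ fun f => ?_
  refine congrArg μ (ContinuousMap.ext fun x => congrArg ν (ContinuousMap.ext fun y =>
    congrArg ρ (ContinuousMap.ext fun z => ?_)))
  exact congrArg f (mul_assoc x y z)

lemma convFun_conv (μ ν : CompactMeasure G) (f : C(G, ℂ)) :
    convFun (conv μ ν) f = convFun μ (convFun ν f) := by
  ext x
  refine congrArg μ (ContinuousMap.ext fun y => congrArg ν (ContinuousMap.ext fun z => ?_))
  exact congrArg f (by simp [mul_assoc])

variable [MeasurableSpace G] [BorelSpace G] (K : Subgroup G) [CompactSpace K]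

/-- The normed Haar measure `ω` of the compact subgroup `K`. -/
def haarK : Measure K := Measure.haarMeasure ⊤

instance : (haarK K).IsHaarMeasure := by unfold haarK; infer_instance

instance : IsProbabilityMeasure (haarK K) :=
  ⟨by simpa [haarK] using Measure.haarMeasure_self (K₀ := (⊤ : PositiveCompacts K))⟩

lemma integral_mul_left_haarK (f : K → ℂ) (k : K) :
    ∫ l, f (k * l) ∂haarK K = ∫ l, f l ∂haarK K :=
  integral_mul_left_eq_self f k

lemma integral_mul_right_haarK (f : K → ℂ) (k : K) :
    ∫ l, f (l * k) ∂haarK K = ∫ l, f l ∂haarK K := by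
  have hm : Measure.map (· * k) (haarK K) = haarK K := by
    have : IsProbabilityMeasure (Measure.map (· * k) (haarK K)) :=
      Measure.isProbabilityMeasure_map (continuous_mul_const k).measurable.aemeasurable
    have : (Measure.map (· * k) (haarK K)).IsHaarMeasure :=
      Measure.isHaarMeasure_map_mul_right (haarK K) k
    exact Measure.isHaarMeasure_eq_of_isProbabilityMeasure _ _
  conv_rhs => rw [← hm]
  exact ((Homeomorph.mulRight k).measurableEmbedding.integral_map f).symm

/-- The projection `f ↦ f^#` of functions. -/
def proj : C(G, ℂ) →L[ℂ] C(G, ℂ) :=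
  partialApply (integralCLM (haarK K)) ∘L partialApply (integralCLM (haarK K)) ∘L
    pullback (⟨fun p : (G × K) × K => (p.1.2 : G) * p.1.1 * (p.2 : G), by fun_prop⟩ :
      C((G × K) × K, G))

lemma proj_apply (f : C(G, ℂ)) (x : G) :
    proj K f x = ∫ k : K, ∫ l : K, f ((k : G) * x * (l : G)) ∂haarK K ∂haarK K :=
  rfl

/-- `C(G//K)`: the continuous functions `f` with `f (k x l) = f x` for all `k, l ∈ K`. -/
def invFun : Submodule ℂ C(G, ℂ) where
  carrier := {f | ∀ x : G, ∀ k ∈ K, ∀ l ∈ K, f (k * x * l) = f x}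
  add_mem' {f g} hf hg x k hk l hl := by simp [hf x k hk l hl, hg x k hk l hl]
  zero_mem' _ _ _ _ _ := rfl
  smul_mem' c f hf x k hk l hl := by simp [hf x k hk l hl]

/-- `M_c(G//K)`: the measures `μ` with `⟨μ, f⟩ = ⟨μ, f^#⟩` for all `f`, with the
weak-* topology. -/
def InvMeasure : Submodule ℂ (CompactMeasure G) where
  carrier := {μ | ∀ f : C(G, ℂ), μ f = μ (proj K f)}
  add_mem' hμ hν f := congrArg₂ (· + ·) (hμ f) (hν f)
  zero_mem' _ := rfl
  smul_mem' c _ hμ f := congrArg (c • ·) (hμ f)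

/-- The function `x ↦ f (a x b)`. -/
def translate (a b : G) (f : C(G, ℂ)) : C(G, ℂ) :=
  f.comp ⟨fun x => a * x * b, by fun_prop⟩

lemma proj_translate (f : C(G, ℂ)) (a b : K) : proj K (translate (a : G) (b : G) f) = proj K f := by
  ext x
  rw [proj_apply, proj_apply]
  have h1 : ∀ k : K, ∫ l : K, translate (a : G) (b : G) f ((k : G) * x * (l : G)) ∂haarK K =
      ∫ l : K, f (((a * k : K) : G) * x * (l : G)) ∂haarK K := by
    intro k
    rw [← integral_mul_right_haarK K (fun l : K => f (((a * k : K) : G) * x * (l : G))) b]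
    simp [translate, mul_assoc]
  simp_rw [h1]
  exact integral_mul_left_haarK K
    (fun k : K => ∫ l : K, f ((k : G) * x * (l : G)) ∂haarK K) a

/-- `K`-invariance of a measure means invariance under two-sided translations by `K`. -/
lemma mem_InvMeasure_iff (μ : CompactMeasure G) :
    μ ∈ InvMeasure K ↔ ∀ (a b : K) (f : C(G, ℂ)), μ (translate (a : G) (b : G) f) = μ f := by
  constructor
  · intro h a b f
    rw [h f, ← proj_translate K f a b]
    exact h _
  · intro h f
    let F : C((G × K) × K, ℂ) :=
      f.comp ⟨fun p => (p.1.2 : G) * p.1.1 * (p.2 : G), by fun_prop⟩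
    have e1 : μ (proj K f) = ∫ k : K, μ.toStrongDual ((partialApply (integralCLM (haarK K)) F).comp
        ⟨fun x => (x, k), by fun_prop⟩) ∂haarK K :=
      functional_integral_comm (haarK K) μ.toStrongDual (partialApply (integralCLM (haarK K)) F)
    have e2 : ∀ k : K, μ.toStrongDual ((partialApply (integralCLM (haarK K)) F).comp
        ⟨fun x => (x, k), by fun_prop⟩) = μ f := by
      intro k
      have := functional_integral_comm (haarK K) μ.toStrongDual
        (F.comp (⟨fun p : G × K => ((p.1, k), p.2), by fun_prop⟩ : C(G × K, (G × K) × K)))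
      refine Eq.trans this ?_
      have e3 : ∀ l : K, μ.toStrongDual ((F.comp
          (⟨fun p : G × K => ((p.1, k), p.2), by fun_prop⟩ : C(G × K, (G × K) × K))).comp
          ⟨fun x => (x, l), by fun_prop⟩) = μ f := fun l => h k l f
      simp_rw [e3]
      simp
    rw [e1]
    simp_rw [e2]
    simp

lemma conv_mem {μ ν : CompactMeasure G} (hμ : μ ∈ InvMeasure K) (hν : ν ∈ InvMeasure K) :
    conv μ ν ∈ InvMeasure K := by
  rw [mem_InvMeasure_iff] at *
  intro a b f
  have h1 : conv μ ν (translate (a : G) (b : G) f) = conv μ ν (translate (a : G) 1 f) := by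
    rw [conv_apply, conv_apply]
    congr 1
    ext x
    refine Eq.trans ?_ (hν 1 b ⟨fun y => translate (a : G) 1 f (x * y), by fun_prop⟩)
    refine congrArg ν ?_
    ext y
    simp [translate, mul_assoc]
  rw [h1]
  refine Eq.trans ?_ (hμ a 1 ⟨fun x => ν ⟨fun y => f (x * y), by fun_prop⟩,
      continuous_inner ν f⟩)
  rw [conv_apply]
  congr 1
  ext x
  refine congrArg ν ?_
  ext y
  simp [translate, mul_assoc]

/-- The projection `δ_y^#` of the point mass at `y`: `⟨δ_y^#, f⟩ = f^#(y)`. -/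
def projDirac (y : G) : InvMeasure K :=
  ⟨StrongDual.toWeakDual (ContinuousMap.evalCLM ℂ y ∘L proj K), by
    rw [mem_InvMeasure_iff]
    intro a b f
    exact DFunLike.congr_fun (proj_translate K f a b) y⟩

lemma projDirac_apply (y : G) (f : C(G, ℂ)) :
    (projDirac K y : CompactMeasure G) f = proj K f y :=
  rfl

lemma projDirac_one_apply (f : C(G, ℂ)) :
    (projDirac K 1 : CompactMeasure G) f = ∫ k : K, f (k : G) ∂haarK K := by
  rw [projDirac_apply, proj_apply]
  have : ∀ k : K, ∫ l : K, f ((k : G) * 1 * (l : G)) ∂haarK K =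
      ∫ l : K, f (l : G) ∂haarK K := by
    intro k
    rw [← integral_mul_left_haarK K (fun l : K => f (l : G)) k]
    simp
  simp_rw [this]
  simp

instance : Mul (InvMeasure K) := ⟨fun μ ν => ⟨conv μ.1 ν.1, conv_mem K μ.2 ν.2⟩⟩

instance : One (InvMeasure K) := ⟨projDirac K 1⟩

lemma coe_mul' (μ ν : InvMeasure K) : ((μ * ν : InvMeasure K) : CompactMeasure G) = conv μ.1 ν.1 :=
  rfl

lemma one_mul' (μ : InvMeasure K) : 1 * μ = μ := by
  refine Subtype.ext (DFunLike.ext _ _ fun f => ?_)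
  refine (projDirac_one_apply K _).trans ?_
  have : ∀ k : K, μ.1 (⟨fun y => f ((k : G) * y), by fun_prop⟩ : C(G, ℂ)) = μ.1 f := by
    intro k
    refine Eq.trans (congrArg μ.1 ?_) ((mem_InvMeasure_iff K μ.1).1 μ.2 k 1 f)
    ext y
    simp [translate]
  refine (integral_congr_ae (Filter.Eventually.of_forall this)).trans ?_
  simp

lemma mul_one' (μ : InvMeasure K) : μ * 1 = μ := by
  refine Subtype.ext (DFunLike.ext _ _ fun f => ?_)
  have e : ∀ x : G, (projDirac K 1 : CompactMeasure G) ⟨fun y => f (x * y), by fun_prop⟩ =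
      ∫ k : K, f (x * (k : G)) ∂haarK K := fun x => projDirac_one_apply K _
  rw [coe_mul', conv_apply]
  have h := functional_integral_comm (haarK K) μ.1.toStrongDual
    (f.comp (⟨fun p : G × K => p.1 * (p.2 : G), by fun_prop⟩ : C(G × K, G)))
  refine Eq.trans (Eq.trans (congrArg μ.1 ?_) h) ?_
  · ext x
    exact e x
  · have h2 : ∀ k : K, μ.1.toStrongDual ((f.comp
        (⟨fun p : G × K => p.1 * (p.2 : G), by fun_prop⟩ : C(G × K, G))).comp
        ⟨fun x => (x, k), by fun_prop⟩) = μ.1 f := by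
      intro k
      refine Eq.trans (congrArg μ.1 ?_) ((mem_InvMeasure_iff K μ.1).1 μ.2 1 k f)
      ext y
      simp [translate]
    simp_rw [h2]
    simp

instance : AddCommGroup (InvMeasure K) := Module.addCommMonoidToAddCommGroup ℂ

/-- The convolution algebra `M_c(G//K)`; its unit is `δ_e^#`. -/
instance : Ring (InvMeasure K) :=
  { (inferInstance : AddCommGroup (InvMeasure K)),
    (inferInstance : Mul (InvMeasure K)),
    (inferInstance : One (InvMeasure K)) with
    mul_assoc := fun μ ν ρ => Subtype.ext (conv_assoc μ.1 ν.1 ρ.1)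
    one_mul := one_mul' K
    mul_one := mul_one' K
    left_distrib := fun μ ν ρ => Subtype.ext <| DFunLike.ext _ _ fun f =>
      map_add μ.1 (partialApply ν.1.toStrongDual (f.comp ⟨fun p : G × G => p.1 * p.2, by fun_prop⟩))
        (partialApply ρ.1.toStrongDual (f.comp ⟨fun p : G × G => p.1 * p.2, by fun_prop⟩))
    right_distrib := fun _ _ _ => rfl
    zero_mul := fun _ => rfl
    mul_zero := fun μ => Subtype.ext <| DFunLike.ext _ _ fun _ => map_zero μ.1 }

instance : Algebra ℂ (InvMeasure K) :=
  Algebra.ofModule (fun _ _ _ => rfl) (fun c μ ν => Subtype.ext <| DFunLike.ext _ _ fun f =>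
    map_smul μ.1 c (partialApply ν.1.toStrongDual
      (f.comp ⟨fun p : G × G => p.1 * p.2, by fun_prop⟩)))

/-- `(G, K)` is a Gelfand pair: the algebra `M_c(G//K)` is commutative. -/
class IsGelfandPair : Prop where
  mul_comm : ∀ μ ν : InvMeasure K, μ * ν = ν * μ

/-- The `K`-translation `τ_y f = δ_{y⁻¹}^# * f`. -/
def translation (y : G) (f : C(G, ℂ)) : C(G, ℂ) := convFun (projDirac K y⁻¹ : CompactMeasure G) f

/-- A `K`-variety: a closed linear subspace of `C(G//K)` (which is closed in `C(G)`) that is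
`K`-translation invariant. -/
structure IsVariety (V : Submodule ℂ C(G, ℂ)) : Prop where
  le_invFun : V ≤ invFun K
  isClosed : IsClosed (V : Set C(G, ℂ))
  translation_mem : ∀ f ∈ V, ∀ y : G, translation K y f ∈ V

/-- `τ(f)`: the intersection of all `K`-varieties containing the `K`-invariant function `f`. -/
def varietyOf (f : C(G, ℂ)) : Submodule ℂ C(G, ℂ) := sInf {V | IsVariety K V ∧ f ∈ V}

/-- `K`-spherical functions: the nonzero `K`-invariant continuous functions with
`∫_K f (x k y) dω(k) = f x f y`. -/
structure IsSpherical (s : C(G, ℂ)) : Prop where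
  mem_invFun : s ∈ invFun K
  ne_zero : s ≠ 0
  map_mul : ∀ x y : G, ∫ k : K, s (x * (k : G) * y) ∂haarK K = s x * s y

section Gelfand

variable [IsGelfandPair K]

instance : CommRing (InvMeasure K) :=
  { (inferInstance : Ring (InvMeasure K)) with mul_comm := IsGelfandPair.mul_comm }

instance : ContinuousAdd (InvMeasure K) where
  continuous_add := Continuous.subtype_mk
    ((continuous_subtype_val.comp continuous_fst).add
      (continuous_subtype_val.comp continuous_snd)) _

/-- Convolution is separately weak-* continuous. -/
instance : ContinuousConstSMul (InvMeasure K) (InvMeasure K) where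
  continuous_const_smul ν := by
    simp_rw [smul_eq_mul, mul_comm ν]
    refine Continuous.subtype_mk (WeakDual.continuous_of_continuous_eval fun f => ?_) _
    exact (WeakDual.eval_continuous
      (partialApply ν.1.toStrongDual (f.comp ⟨fun p : G × G => p.1 * p.2, by fun_prop⟩))).comp
      continuous_subtype_val

/-- The annihilator of a subspace `V` of `C(G//K)` in `M_c(G//K)`. -/
def ann (V : Submodule ℂ C(G, ℂ)) : Ideal (InvMeasure K) where
  carrier := {μ | ∀ f ∈ V, convFun (μ : CompactMeasure G) f = 0}
  add_mem' {μ ν} hμ hν f hf := by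
    have : convFun ((μ + ν : InvMeasure K) : CompactMeasure G) f =
      convFun (μ : CompactMeasure G) f + convFun (ν : CompactMeasure G) f := rfl
    rw [this, hμ f hf, hν f hf, add_zero]
  zero_mem' _ _ := rfl
  smul_mem' ν μ hμ f hf := by
    rw [smul_eq_mul, coe_mul', convFun_conv, hμ f hf, map_zero]

/-- The modified `K`-spherical difference `D_{f;y} = δ_{y⁻¹}^# - f(y) δ_e`; here `δ_e` is the unit
of `M_c(G//K)`. -/
def sphDiff (f : C(G, ℂ)) (y : G) : InvMeasure K := projDirac K y⁻¹ - f y • (1 : InvMeasure K)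

/-- `M_f`: the (weak-*) closure of the ideal generated by all `D_{f;y}`, `y ∈ G`. -/
def sphIdeal (f : C(G, ℂ)) : Ideal (InvMeasure K) :=
  Submodule.topologicalClosure (Ideal.span (Set.range (sphDiff K f)))

/-- Exponential maximal ideals: the maximal ideals of `M_c(G//K)` which are the kernel of a
continuous algebra homomorphism of `M_c(G//K)` onto `ℂ`. -/
def IsExponentialMaximal (M : Ideal (InvMeasure K)) : Prop :=
  M.IsMaximal ∧ ∃ Φ : InvMeasure K →ₐ[ℂ] ℂ,
    Continuous Φ ∧ Function.Surjective Φ ∧ RingHom.ker Φ = M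

/-- The equation `D_{s;y₁} * ⋯ * D_{s;yₙ₊₁} * φ = 0` for all `y₁, …, yₙ₊₁ ∈ G`. -/
def SphDiffEq (s : C(G, ℂ)) (n : ℕ) (φ : C(G, ℂ)) : Prop :=
  ∀ (y : Fin (n + 1) → G) (x : G),
    convFun ((∏ i, sphDiff K s (y i) : InvMeasure K) : CompactMeasure G) φ x = 0

/-- Generalized `K`-spherical monomials. -/
def IsGenMonomial (φ : C(G, ℂ)) : Prop :=
  φ ∈ invFun K ∧ ∃ s : C(G, ℂ), IsSpherical K s ∧ ∃ n : ℕ, SphDiffEq K s n φ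

end Gelfand

end Group

end KSpherical

end

/-! A spherical function `s` is a common eigenfunction: μ * s = χ(μ) s with χ(μ) = ∫ s(y⁻¹) dμ(y),
so χ is a weak-* continuous character (`IsSpherical.convFun_eq`, `IsSpherical.character`). It kills
every D_{s;y}, and since the δ_y^# span a dense subspace, M_s is exactly ker χ
(`IsSpherical.sphIdeal_eq_ker`). Conversely a weak-* continuous character is evaluation at a
function, whose reflection is spherical (`exists_isSpherical`).

By commutativity Ann τ(φ) is the annihilator of φ alone; it is weak-* closed, and proper when φ ≠ 0.
Equation (1) says that it contains the (n+1)-st power of the ideal generated by the D_{s;y}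
(`sphDiffEq_iff`), and separate continuity carries this over to the closure M_s. A maximal ideal
above Ann τ(φ) is prime and contains M_s^{n+1}, so it is M_s; the same primeness argument gives
uniqueness. -/

namespace KSpherical

/-! ### Powers of ideals and topological closure -/

/-- Powers of the closure of an ideal lie in every closed ideal containing the same power. -/
lemma topologicalClosure_mul_le {R : Type*} [CommRing R] [TopologicalSpace R] [ContinuousAdd R]
    [ContinuousConstSMul R R] {I L J : Ideal R} (hJ : IsClosed (J : Set R)) (h : I * L ≤ J) :
    Submodule.topologicalClosure I * L ≤ J := by
  refine Ideal.mul_le.2 fun a ha b hb => ?_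
  have hc : IsClosed {a : R | a * b ∈ J} := by
    simp_rw [mul_comm _ b]
    exact hJ.preimage (continuous_const_smul b)
  exact closure_minimal (fun c hc => Ideal.mul_le.1 h c hc b hb) hc ha

/-- Multiplication is only separately continuous, so the factors are closed up one at a time; `L`
holds the factors not being treated and must therefore vary in the induction. -/
lemma topologicalClosure_pow_mul_le {R : Type*} [CommRing R] [TopologicalSpace R]
    [ContinuousAdd R] [ContinuousConstSMul R R] {I J : Ideal R} (hJ : IsClosed (J : Set R))
    (n : ℕ) {L : Ideal R} (h : I ^ n * L ≤ J) : Submodule.topologicalClosure I ^ n * L ≤ J := by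
  induction n generalizing L with
  | zero => simpa using h
  | succ n ih =>
    rw [pow_succ', mul_assoc]
    refine topologicalClosure_mul_le hJ ?_
    rw [mul_left_comm]
    exact ih (by rwa [← mul_assoc, ← pow_succ])

lemma topologicalClosure_pow_le {R : Type*} [CommRing R] [TopologicalSpace R]
    [ContinuousAdd R] [ContinuousConstSMul R R] {I J : Ideal R} (hJ : IsClosed (J : Set R))
    {n : ℕ} (h : I ^ n ≤ J) : Submodule.topologicalClosure I ^ n ≤ J := by
  simpa using topologicalClosure_pow_mul_le hJ n (L := ⊤) (by simpa using h)

end KSpherical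

namespace KSpherical

variable {G : Type*} [Group G] [TopologicalSpace G] [IsTopologicalGroup G]
  [LocallyCompactSpace G]

/-! ### Invariant functions and the action of invariant measures -/

/-- The function `x ↦ f x⁻¹`. -/
noncomputable def reflect (f : C(G, ℂ)) : C(G, ℂ) := f.comp ⟨fun x => x⁻¹, by fun_prop⟩

@[simp] lemma reflect_apply (f : C(G, ℂ)) (x : G) : reflect f x = f x⁻¹ := rfl

variable (K : Subgroup G)

lemma isClosed_invFun : IsClosed (invFun K : Set C(G, ℂ)) := by
  have : (invFun K : Set C(G, ℂ)) =
      ⋂ (x : G) (k ∈ K) (l ∈ K), {f : C(G, ℂ) | f (k * x * l) = f x} := by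
    ext f
    simp only [Set.mem_iInter]
    rfl
  rw [this]
  refine isClosed_iInter fun x => isClosed_biInter fun k _ => isClosed_biInter fun l _ => ?_
  exact isClosed_eq (ContinuousEvalConst.continuous_eval_const _)
    (ContinuousEvalConst.continuous_eval_const _)

variable {K} in
lemma invFun_mul_left {f : C(G, ℂ)} (hf : f ∈ invFun K) (k : K) (x : G) : f ((k : G) * x) = f x := by
  simpa using hf x k k.2 1 K.one_mem

variable {K} in
lemma invFun_mul_right {f : C(G, ℂ)} (hf : f ∈ invFun K) (x : G) (k : K) : f (x * (k : G)) = f x := by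
  simpa using hf x 1 K.one_mem k k.2

lemma reflect_mem_invFun {f : C(G, ℂ)} (hf : f ∈ invFun K) : reflect f ∈ invFun K := by
  intro x k hk l hl
  simpa [mul_assoc] using hf x⁻¹ l⁻¹ (K.inv_mem hl) k⁻¹ (K.inv_mem hk)

variable [MeasurableSpace G] [BorelSpace G] [CompactSpace K]

instance : (haarK K).IsMulRightInvariant where
  map_mul_right_eq_self k := by
    have : IsProbabilityMeasure (Measure.map (· * k) (haarK K)) :=
      Measure.isProbabilityMeasure_map (continuous_mul_const k).measurable.aemeasurable
    have : (Measure.map (· * k) (haarK K)).IsHaarMeasure :=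
      Measure.isHaarMeasure_map_mul_right (haarK K) k
    exact Measure.isHaarMeasure_eq_of_isProbabilityMeasure _ _

/-- A compact group is unimodular: right invariance makes the inverted measure left invariant, and a
Haar probability measure is unique. -/
lemma integral_inv_haarK (f : K → ℂ) : ∫ k, f k⁻¹ ∂haarK K = ∫ k, f k ∂haarK K := by
  have : IsProbabilityMeasure (haarK K).inv :=
    Measure.isProbabilityMeasure_map continuous_inv.measurable.aemeasurable
  have : (haarK K).inv.IsHaarMeasure :=
    { toIsOpenPosMeasure := (Continuous.isOpenPosMeasure_map continuous_inv inv_surjective)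
      toIsMulLeftInvariant := inferInstance
      lt_top_of_isCompact := fun _ _ => measure_lt_top _ _ }
  conv_rhs => rw [← Measure.isHaarMeasure_eq_of_isProbabilityMeasure (haarK K).inv (haarK K)]
  exact ((Homeomorph.inv K).measurableEmbedding.integral_map f).symm

lemma proj_mem_invFun (f : C(G, ℂ)) : proj K f ∈ invFun K := by
  intro x k hk l hl
  have h : ∀ a : K, ∫ b : K, f ((a : G) * (k * x * l) * (b : G)) ∂haarK K =
      ∫ b : K, f (((a * ⟨k, hk⟩ : K) : G) * x * (b : G)) ∂haarK K := by
    intro a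
    rw [← integral_mul_left_haarK K
      (fun b : K => f (((a * ⟨k, hk⟩ : K) : G) * x * (b : G))) ⟨l, hl⟩]
    simp [mul_assoc]
  rw [proj_apply, proj_apply]
  simp_rw [h]
  exact integral_mul_right_haarK K
    (fun a : K => ∫ b : K, f ((a : G) * x * (b : G)) ∂haarK K) ⟨k, hk⟩

variable {K} in
lemma proj_eq_self {f : C(G, ℂ)} (hf : f ∈ invFun K) : proj K f = f := by
  ext x
  have h : ∀ k l : K, f ((k : G) * x * (l : G)) = f x := fun k l => hf x k k.2 l l.2
  rw [proj_apply]
  simp [h]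

lemma continuous_apply_InvMeasure (f : C(G, ℂ)) :
    Continuous fun μ : InvMeasure K => μ.1 f :=
  (WeakDual.eval_continuous f).comp continuous_subtype_val

lemma continuous_convFun_apply (f : C(G, ℂ)) (x : G) :
    Continuous fun μ : InvMeasure K => convFun μ.1 f x :=
  continuous_apply_InvMeasure K (⟨fun y => f (y⁻¹ * x), by fun_prop⟩ : C(G, ℂ))

lemma convFun_mul (μ ν : InvMeasure K) (f : C(G, ℂ)) :
    convFun (μ * ν).1 f = convFun μ.1 (convFun ν.1 f) := convFun_conv _ _ _

lemma convFun_one {f : C(G, ℂ)} (hf : f ∈ invFun K) :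
    convFun (1 : InvMeasure K).1 f = f := by
  ext x
  refine (projDirac_one_apply K _).trans ?_
  have : ∀ k : K, f ((k : G)⁻¹ * x) = f x := fun k => by
    simpa using invFun_mul_left hf k⁻¹ x
  refine (integral_congr_ae (Filter.Eventually.of_forall this)).trans ?_
  simp

/-- Right invariance comes from `f`, left invariance from `μ`, because f(y⁻¹kx) = f((k⁻¹y)⁻¹x). -/
lemma convFun_mem_invFun (μ : InvMeasure K) {f : C(G, ℂ)} (hf : f ∈ invFun K) :
    convFun μ.1 f ∈ invFun K := by
  intro x k hk l hl
  rw [convFun_apply, convFun_apply]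
  refine Eq.trans (congrArg μ.1 ?_) ((mem_InvMeasure_iff K μ.1).1 μ.2 (⟨k, hk⟩⁻¹ : K) 1 _)
  ext y
  have := hf (y⁻¹ * (k * x)) 1 K.one_mem l hl
  simpa [translate, mul_assoc] using this

/-- This links multiplicativity on the δ_y^# with the spherical functional equation. The outer
averages are absorbed by `h`, and the two in the middle merge by invariance of Haar measure. -/
lemma projDirac_mul_projDirac_apply {h : C(G, ℂ)} (hh : h ∈ invFun K) (x y : G) :
    (projDirac K x * projDirac K y).1 h = ∫ k : K, h (x * (k : G) * y) ∂haarK K := by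
  have h1 : ∀ z : G, (projDirac K y).1 ⟨fun w => h (z * w), by fun_prop⟩ =
      ∫ k : K, h (z * (k : G) * y) ∂haarK K := by
    intro z
    rw [projDirac_apply, proj_apply]
    have : ∀ k l : K, h (z * ((k : G) * y * (l : G))) = h (z * (k : G) * y) := fun k l => by
      rw [← invFun_mul_right hh (z * (k : G) * y) l]
      simp [mul_assoc]
    simp [this]
  rw [coe_mul', conv_apply, projDirac_apply, proj_apply]
  have h2 : ∀ a b : K, (projDirac K y).1 ⟨fun w => h ((a : G) * x * (b : G) * w), by fun_prop⟩ =
      ∫ k : K, h (x * (k : G) * y) ∂haarK K := by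
    intro a b
    rw [h1, ← integral_mul_left_haarK K (fun k : K => h (x * (k : G) * y)) b]
    refine integral_congr_ae (Filter.Eventually.of_forall fun k => ?_)
    show h ((a : G) * x * (b : G) * (k : G) * y) = h (x * ((b * k : K) : G) * y)
    rw [← invFun_mul_left hh a (x * ((b * k : K) : G) * y)]
    simp [mul_assoc]
  have h3 : ∀ a b : K, (⟨fun x => (projDirac K y).1 ⟨fun w => h (x * w), by fun_prop⟩,
      continuous_inner (projDirac K y).1 h⟩ : C(G, ℂ)) ((a : G) * x * (b : G)) =
      ∫ k : K, h (x * (k : G) * y) ∂haarK K := h2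
  simp_rw [h3]
  simp

/-! ### Spherical functions and their characters -/

/-- Convolution with an invariant measure acts on spherical functions as a scalar. -/
lemma IsSpherical.convFun_eq {s : C(G, ℂ)} (hs : IsSpherical K s) (μ : InvMeasure K) :
    convFun μ.1 s = μ.1 (reflect s) • s := by
  ext x
  rw [convFun_apply, μ.2]
  -- Once μ is tested on the projected function, the K-average of s(y⁻¹kx) appears and the
  -- functional equation factors it.
  have h : proj K (⟨fun y => s (y⁻¹ * x), by fun_prop⟩ : C(G, ℂ)) = s x • reflect s := by
    ext y
    rw [proj_apply]
    have h1 : ∀ k l : K, s (((k : G) * y * (l : G))⁻¹ * x) =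
        s (y⁻¹ * ((k⁻¹ : K) : G) * x) := fun k l => by
      rw [← invFun_mul_left hs.mem_invFun l⁻¹ (y⁻¹ * ((k⁻¹ : K) : G) * x)]
      simp [mul_assoc]
    simp only [ContinuousMap.coe_mk, h1]
    simp only [integral_const, probReal_univ, one_smul]
    rw [integral_inv_haarK K (fun k : K => s (y⁻¹ * (k : G) * x)), hs.map_mul]
    simp [mul_comm]
  rw [h, map_smul]
  simp [mul_comm]

lemma IsSpherical.apply_one {s : C(G, ℂ)} (hs : IsSpherical K s) : s 1 = 1 := by
  obtain ⟨x, hx⟩ : ∃ x, s x ≠ 0 := by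
    by_contra! h
    exact hs.ne_zero (ContinuousMap.ext h)
  have := hs.map_mul x 1
  simp only [mul_one, invFun_mul_right hs.mem_invFun, integral_const, probReal_univ,
    one_smul] at this
  exact mul_left_cancel₀ hx (by rw [← this, mul_one])

/-- The algebra homomorphism `μ ↦ ∫ s(y⁻¹) dμ(y)` attached to a spherical function `s`. -/
noncomputable def IsSpherical.character {s : C(G, ℂ)} (hs : IsSpherical K s) : InvMeasure K →ₐ[ℂ] ℂ :=
  AlgHom.ofLinearMap
    { toFun := fun μ => μ.1 (reflect s)
      map_add' := fun _ _ => rfl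
      map_smul' := fun _ _ => rfl }
    (by
      refine (projDirac_one_apply K _).trans ?_
      have : ∀ k : K, reflect s (k : G) = 1 := fun k => by
        rw [reflect_apply, ← hs.apply_one]
        simpa using invFun_mul_left hs.mem_invFun k⁻¹ 1
      simp [this])
    (by
      intro μ ν
      have h := convFun_mul K μ ν s
      rw [hs.convFun_eq, hs.convFun_eq, map_smul, hs.convFun_eq, smul_smul] at h
      have := DFunLike.congr_fun h 1
      rw [ContinuousMap.smul_apply, ContinuousMap.smul_apply, hs.apply_one, smul_eq_mul,
        smul_eq_mul, mul_one, mul_one, mul_comm] at this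
      exact this)

lemma IsSpherical.character_apply {s : C(G, ℂ)} (hs : IsSpherical K s) (μ : InvMeasure K) :
    hs.character K μ = μ.1 (reflect s) := rfl

lemma IsSpherical.continuous_character {s : C(G, ℂ)} (hs : IsSpherical K s) :
    Continuous (hs.character K) := continuous_apply_InvMeasure K _

lemma IsSpherical.character_sphDiff {s : C(G, ℂ)} (hs : IsSpherical K s) (y : G) :
    hs.character K (sphDiff K s y) = 0 := by
  rw [sphDiff, map_sub, map_smul, map_one, hs.character_apply, projDirac_apply,
    proj_eq_self (reflect_mem_invFun K hs.mem_invFun)]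
  simp

/-! ### Weak-* density and duality -/

lemma isInducing_InvMeasure :
    IsInducing (fun (μ : InvMeasure K) (f : C(G, ℂ)) => μ.1 f) :=
  (show IsInducing (fun (μ : CompactMeasure G) (f : C(G, ℂ)) => μ f) from ⟨rfl⟩).comp
    IsInducing.subtypeVal

/-- Linear combinations of the measures `δ_y^#` are weak-* dense. -/
lemma dense_span_projDirac :
    Dense (Submodule.span ℂ (Set.range (projDirac K)) : Set (InvMeasure K)) := by
  intro μ
  rw [(isInducing_InvMeasure K).closure_eq_preimage_closure_image, Set.mem_preimage,
    mem_closure_iff_nhds]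
  intro U hU
  rw [nhds_pi, Filter.mem_pi] at hU
  obtain ⟨I, hI, t, ht, hU⟩ := hU
  have : Fintype I := hI.fintype
  let P : InvMeasure K →ₗ[ℂ] (I → ℂ) :=
    { toFun := fun μ i => μ.1 i
      map_add' := fun _ _ => rfl
      map_smul' := fun _ _ => rfl }
  -- A basic neighbourhood restricts only the finitely many values μ(i), i ∈ I, so it suffices to
  -- match these exactly.
  have hP : P μ ∈ (Submodule.span ℂ (Set.range (projDirac K))).map P := by
    by_contra hμ
    obtain ⟨ξ, hξ, hle⟩ := Submodule.exists_le_ker_of_notMem hμ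
    classical
    -- A separating functional on ℂ^I is evaluation at this combination `F`; if it kills all δ_y^#,
    -- then F^# = 0 and so μ(F) = μ(F^#) = 0.
    let F : C(G, ℂ) := ∑ i : I, ξ (Pi.single i 1) • (i : C(G, ℂ))
    have hξF : ∀ ν : InvMeasure K, ξ (P ν) = ν.1 F := by
      intro ν
      rw [LinearMap.pi_apply_eq_sum_univ ξ (P ν), map_sum]
      refine Finset.sum_congr rfl fun i _ => ?_
      rw [map_smul, smul_eq_mul, smul_eq_mul, mul_comm]
      congr 2
      ext j
      simp [Pi.single_apply, eq_comm]
    refine hξ ?_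
    have h0 : proj K F = 0 := by
      ext y
      rw [← projDirac_apply, ← hξF]
      exact hle ⟨_, Submodule.subset_span ⟨y, rfl⟩, rfl⟩
    rw [hξF, μ.2, h0, map_zero]
  obtain ⟨ν, hν, hνμ⟩ := hP
  refine ⟨_, hU fun f hf => ?_, ν, hν, rfl⟩
  have : ν.1 f = μ.1 f := congrFun hνμ ⟨f, hf⟩
  show ν.1 f ∈ t f
  rw [this]
  exact mem_of_mem_nhds (ht f)

/-- Weak-* continuous functionals are given by functions. -/
lemma exists_eq_apply (Φ : InvMeasure K →ₗ[ℂ] ℂ) (hΦ : Continuous Φ) :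
    ∃ f ∈ invFun K, ∀ μ : InvMeasure K, Φ μ = μ.1 f := by
  let ev : C(G, ℂ) →ₗ[ℂ] InvMeasure K →ₗ[ℂ] ℂ :=
    { toFun := fun f =>
        { toFun := fun μ => μ.1 f
          map_add' := fun _ _ => rfl
          map_smul' := fun _ _ => rfl }
      map_add' := fun f g => LinearMap.ext fun μ => map_add μ.1 f g
      map_smul' := fun c f => LinearMap.ext fun μ => map_smul μ.1 c f }
  have h : Φ ∈ Submodule.span ℂ (Set.range ev) := by
    -- A functional continuous for the topology induced by a family of functionals is a linear
    -- combination of them.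
    rw [LinearMap.mem_span_iff_continuous, ← induced_to_pi]
    exact (isInducing_InvMeasure K).eq_induced ▸ hΦ
  rw [← LinearMap.coe_range, Submodule.span_eq] at h
  obtain ⟨f, rfl⟩ := h
  exact ⟨proj K f, proj_mem_invFun K f, fun μ => μ.2 f⟩

/-! ### Maximal ideals and annihilators -/

section Gelfand

variable [IsGelfandPair K]

/-- The continuous map T(ν) = ν − χ(ν)·1 fixes ker χ and sends δ_y^# to D_{s;y⁻¹}. By density its
whole image lies in the closed ideal M_s. -/
lemma IsSpherical.sphIdeal_eq_ker {s : C(G, ℂ)} (hs : IsSpherical K s) :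
    sphIdeal K s = RingHom.ker (hs.character K) := by
  have hclosed : IsClosed (RingHom.ker (hs.character K) : Set (InvMeasure K)) :=
    isClosed_singleton.preimage (hs.continuous_character K)
  refine le_antisymm ?_ fun μ hμ => ?_
  · refine Submodule.topologicalClosure_minimal _ (Ideal.span_le.2 ?_) hclosed
    rintro _ ⟨y, rfl⟩
    exact hs.character_sphDiff K y
  · let T : InvMeasure K →ₗ[ℂ] InvMeasure K :=
      LinearMap.id - (hs.character K).toLinearMap.smulRight 1
    have hT : Continuous T := by
      have h1 : Continuous fun c : ℂ => c • (1 : InvMeasure K) :=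
        (isInducing_InvMeasure K).continuous_iff.2 (continuous_pi fun f =>
          (continuous_id.mul continuous_const : Continuous fun c : ℂ => c * (1 : InvMeasure K).1 f))
      have h2 : T = fun ν => ν + (-hs.character K ν) • (1 : InvMeasure K) := by
        ext1 ν
        rw [neg_smul, ← sub_eq_add_neg]
        rfl
      rw [h2]
      exact continuous_id.add (h1.comp (hs.continuous_character K).neg)
    have hle : Submodule.span ℂ (Set.range (projDirac K)) ≤
        ((sphIdeal K s).restrictScalars ℂ).comap T := by
      rw [Submodule.span_le]
      rintro _ ⟨y, rfl⟩
      have : T (projDirac K y) = sphDiff K s y⁻¹ := by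
        show projDirac K y - hs.character K (projDirac K y) • 1 = _
        rw [hs.character_apply, projDirac_apply,
          proj_eq_self (reflect_mem_invFun K hs.mem_invFun), sphDiff, inv_inv, reflect_apply]
      show T (projDirac K y) ∈ sphIdeal K s
      rw [this]
      exact Submodule.le_topologicalClosure _ (Ideal.subset_span ⟨_, rfl⟩)
    have hcl : IsClosed {ν | T ν ∈ sphIdeal K s} :=
      (Submodule.isClosed_topologicalClosure _).preimage hT
    have hμT : T μ ∈ sphIdeal K s :=
      closure_minimal (fun _ h => hle h) hcl (dense_span_projDirac K μ)
    have : T μ = μ := by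
      show μ - hs.character K μ • 1 = μ
      rw [(RingHom.mem_ker).1 hμ, zero_smul, sub_zero]
    rwa [this] at hμT

lemma surjective_algHom (Φ : InvMeasure K →ₐ[ℂ] ℂ) : Function.Surjective Φ :=
  fun c => ⟨algebraMap ℂ _ c, Φ.commutes c⟩

lemma IsSpherical.isExponentialMaximal {s : C(G, ℂ)} (hs : IsSpherical K s) :
    IsExponentialMaximal K (sphIdeal K s) := by
  have hsurj := surjective_algHom K (hs.character K)
  refine ⟨?_, hs.character K, hs.continuous_character K, hsurj, (hs.sphIdeal_eq_ker K).symm⟩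
  rw [hs.sphIdeal_eq_ker K]
  exact RingHom.ker_isMaximal_of_surjective _ hsurj

lemma isClosed_ann (V : Submodule ℂ C(G, ℂ)) : IsClosed (ann K V : Set (InvMeasure K)) := by
  have : (ann K V : Set (InvMeasure K)) =
      ⋂ (f ∈ V) (x : G), {μ : InvMeasure K | convFun μ.1 f x = 0} := by
    ext μ
    simp only [Set.mem_iInter]
    exact forall₂_congr fun f _ => DFunLike.ext_iff
  rw [this]
  exact isClosed_biInter fun f _ => isClosed_iInter fun x =>
    isClosed_singleton.preimage (continuous_convFun_apply K f x)

/-- The invariant functions annihilated by a given measure form a variety. -/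
lemma isVariety_ker (μ : InvMeasure K) :
    IsVariety K (invFun K ⊓ LinearMap.ker (convFun μ.1).toLinearMap) where
  le_invFun := inf_le_left
  isClosed := (isClosed_invFun K).inter (isClosed_singleton.preimage (convFun μ.1).continuous)
  translation_mem f hf y := by
    refine ⟨convFun_mem_invFun K _ hf.1, ?_⟩
    have h0 : convFun μ.1 f = 0 := hf.2
    show convFun μ.1 (convFun (projDirac K y⁻¹).1 f) = 0
    -- The Gelfand property lets μ pass the translation.
    rw [← convFun_mul, mul_comm, convFun_mul, h0, map_zero]

lemma mem_varietyOf (f : C(G, ℂ)) : f ∈ varietyOf K f :=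
  Submodule.mem_sInf.2 fun _ h => h.2

/-- The kernel of a measure is itself a variety, so it contains τ(f) as soon as it contains f. -/
lemma mem_ann_varietyOf_iff {f : C(G, ℂ)} (hf : f ∈ invFun K) (μ : InvMeasure K) :
    μ ∈ ann K (varietyOf K f) ↔ convFun μ.1 f = 0 := by
  refine ⟨fun h => h f (mem_varietyOf K f), fun h g hg => ?_⟩
  exact (Submodule.mem_sInf.1 hg _ ⟨isVariety_ker K μ, hf, h⟩).2

lemma ann_varietyOf_ne_top {f : C(G, ℂ)} (hf : f ∈ invFun K) (hf0 : f ≠ 0) :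
    ann K (varietyOf K f) ≠ ⊤ := by
  rw [Ideal.ne_top_iff_one, mem_ann_varietyOf_iff K hf, convFun_one K hf]
  exact hf0

/-- The power of the ideal is spanned by the products of n + 1 generators, and these are the
operators in (1). -/
lemma sphDiffEq_iff {f : C(G, ℂ)} (hf : f ∈ invFun K) (s : C(G, ℂ)) (n : ℕ) :
    SphDiffEq K s n f ↔
      Ideal.span (Set.range (sphDiff K s)) ^ (n + 1) ≤ ann K (varietyOf K f) := by
  have key : SphDiffEq K s n f ↔
      ∀ y : Fin (n + 1) → G, ∏ i, sphDiff K s (y i) ∈ ann K (varietyOf K f) := by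
    simp_rw [mem_ann_varietyOf_iff K hf, DFunLike.ext_iff]
    rfl
  rw [key, Ideal.span, Submodule.span_pow, Submodule.span_le]
  constructor
  · rintro h _ hμ
    obtain ⟨g, rfl⟩ := Set.mem_pow.1 hμ
    choose y hy using fun i => (g i).2
    simp_rw [← hy, List.prod_ofFn]
    exact h y
  · intro h y
    refine h (Set.mem_pow.2 ⟨fun i => ⟨sphDiff K s (y i), y i, rfl⟩, ?_⟩)
    rw [List.prod_ofFn]

/-- The unique exponential maximal ideal attached to a generalized spherical monomial. -/
theorem sphIdeal_properties {f s : C(G, ℂ)} (hf : f ∈ invFun K) (hf0 : f ≠ 0)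
    (hs : IsSpherical K s) {n : ℕ} (h : SphDiffEq K s n f) :
    sphIdeal K s ^ (n + 1) ≤ ann K (varietyOf K f) ∧ ann K (varietyOf K f) ≤ sphIdeal K s ∧
      ∀ M : Ideal (InvMeasure K), IsExponentialMaximal K M →
        (∃ m : ℕ, M ^ (m + 1) ≤ ann K (varietyOf K f)) → M = sphIdeal K s := by
  have hmax := (hs.isExponentialMaximal K).1
  have hpow : sphIdeal K s ^ (n + 1) ≤ ann K (varietyOf K f) :=
    topologicalClosure_pow_le (isClosed_ann K _) ((sphDiffEq_iff K hf s n).1 h)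
  have hle : ann K (varietyOf K f) ≤ sphIdeal K s := by
    -- The prime ideal `P` contains M_s^{n+1}, hence M_s, and equals it by maximality of M_s.
    obtain ⟨P, hP, hAP⟩ := Ideal.exists_le_maximal _ (ann_varietyOf_ne_top K hf hf0)
    have := hP.isPrime
    rwa [hmax.eq_of_le hP.ne_top (Ideal.IsPrime.le_of_pow_le (hpow.trans hAP))]
  refine ⟨hpow, hle, fun M hM => ?_⟩
  rintro ⟨m, hm⟩
  have := hmax.isPrime
  exact hM.1.eq_of_le hmax.ne_top (Ideal.IsPrime.le_of_pow_le (hm.trans hle))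

/-- Every weak-* continuous character comes from a spherical function. -/
lemma exists_isSpherical (Φ : InvMeasure K →ₐ[ℂ] ℂ) (hΦ : Continuous Φ) :
    ∃ s, IsSpherical K s ∧ ∀ y, Φ (sphDiff K s y) = 0 := by
  obtain ⟨f, hf, hΦf⟩ := exists_eq_apply K Φ.toLinearMap hΦ
  have hδ : ∀ y, Φ (projDirac K y) = f y := fun y => by
    rw [← AlgHom.toLinearMap_apply, hΦf, projDirac_apply, proj_eq_self hf]
  have h1 : f 1 = 1 := (hδ 1).symm.trans (map_one Φ)
  -- The reflection matches the inverse in D_{s;y}: Φ(δ_{y⁻¹}^#) = f(y⁻¹) must be s(y).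
  refine ⟨reflect f, ⟨reflect_mem_invFun K hf, ?_, fun x y => ?_⟩, fun y => ?_⟩
  · intro h
    have := DFunLike.congr_fun h 1
    simp [h1] at this
  -- Inversion reverses x k y, hence the order y⁻¹, x⁻¹ and the substitution k ↦ k⁻¹.
  · have h2 := map_mul Φ (projDirac K y⁻¹) (projDirac K x⁻¹)
    rw [hδ, hδ, ← AlgHom.toLinearMap_apply, hΦf, projDirac_mul_projDirac_apply K hf,
      ← integral_inv_haarK K (fun k : K => f (y⁻¹ * (k : G) * x⁻¹))] at h2
    simpa [mul_assoc, mul_comm (f x⁻¹)] using h2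
  · rw [sphDiff, map_sub, map_smul, map_one, hδ]
    simp

end Gelfand

end KSpherical

open KSpherical in
theorem mainTheorem10 {G : Type*} [Group G] [TopologicalSpace G] [IsTopologicalGroup G]
    [LocallyCompactSpace G] [T2Space G] [MeasurableSpace G] [BorelSpace G]
    (K : Subgroup G) [CompactSpace K] [IsGelfandPair K]
    (φ : C(G, ℂ)) (hφ : φ ∈ invFun K) (hφ0 : φ ≠ 0) :
    (IsGenMonomial K φ ↔
      ∃! M : Ideal (InvMeasure K), IsExponentialMaximal K M ∧
        ∃ n : ℕ, M ^ (n + 1) ≤ ann K (varietyOf K φ)) ∧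
    (∀ (s : C(G, ℂ)) (n : ℕ), IsSpherical K s → SphDiffEq K s n φ →
      IsExponentialMaximal K (sphIdeal K s) ∧
      sphIdeal K s ^ (n + 1) ≤ ann K (varietyOf K φ) ∧
      ann K (varietyOf K φ) ≤ sphIdeal K s ∧
      ∀ M : Ideal (InvMeasure K), IsExponentialMaximal K M →
        (∃ m : ℕ, M ^ (m + 1) ≤ ann K (varietyOf K φ)) → M = sphIdeal K s) := by
  refine ⟨⟨?_, ?_⟩, fun s n hs h =>
    ⟨hs.isExponentialMaximal K, sphIdeal_properties K hφ hφ0 hs h⟩⟩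
  · rintro ⟨-, s, hs, n, h⟩
    obtain ⟨hpow, -, huniq⟩ := sphIdeal_properties K hφ hφ0 hs h
    exact ⟨sphIdeal K s, ⟨hs.isExponentialMaximal K, n, hpow⟩, fun M hM => huniq M hM.1 hM.2⟩
  · rintro ⟨M, ⟨⟨-, Φ, hΦ, -, rfl⟩, n, hn⟩, -⟩
    obtain ⟨s, hs, hker⟩ := exists_isSpherical K Φ hΦ
    -- All D_{s;y} lie in ker Φ = M, so (1) holds with the same n.
    refine ⟨hφ, s, hs, n, (sphDiffEq_iff K hφ s n).2 (le_trans (Ideal.pow_right_mono ?_ _) hn)⟩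
    rw [Ideal.span_le]
    rintro _ ⟨y, rfl⟩
    exact hker y
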